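/- Let $\mathcal H_{A_1},\mathcal H_{B_1},\mathcal H_{A_2},\mathcal H_{B_2}$ be finite-dimensional complex Hilbert spaces with fixed orthonormal bases and with $\dim\mathcal H_{A_2}\ge 2$, $\dim\mathcal H_{B_2}\ge 2$. For a linear map $\Lambda:\mathcal L(\mathcal H_{A_1}\otimes\mathcal H_{B_1})\to\mathcal L(\mathcal H_{A_2}\otimes\mathcal H_{B_2})$ let $J(\Lambda)=(\Lambda\otimes\mathrm{id})\big(\sum_{i,j}|i\rangle\langle j|\otimes|i\rangle\langle j|\big)$ be its Choi operator, where $\{|i\rangle\}$ is the product basis of $\mathcal H_{A_1}\otimes\mathcal H_{B_1}$. A positive semidefinite operator is separable with respect to a bipartition $A:B$ if it is a finite sum $\sum_k\tau_k\otimes\omega_k$ with $\tau_k,\omega_k\ge 0$ acting on $A$ and $B$, and entangled otherwise; a Hermitian operator $W$ is an entanglement witness with respect to $A:B$ if $\operatorname{Tr}(W\sigma)\ge 0$ for every separable state $\sigma$. Let $W_1,\dots,W_n$ be finitely many entanglement witnesses on $\mathcal H_{A_2}\otimes\mathcal H_{B_2}\otimes\mathcal H_{A_1}\otimes\mathcal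 H_{B_1}$ with respect to the bipartition $A_2A_1:B_2B_1$. Then there is an entangled state $\rho$ on $\mathcal H_{A_2}\otimes\mathcal H_{B_2}$ with the following properties. 1. $\rho$ is a two-qubit state, i.e. $\rho=(U\otimes V)\rho_0(U\otimes V)^\dagger$ for a state $\rho_0$ on $\mathbb C^2\otimes\mathbb C^2$ and isometries $U:\mathbb C^2\to\mathcal H_{A_2}$, $V:\mathbb C^2\to\mathcal H_{B_2}$. 2. $\rho$ is distillable under LOCC: there are channels $\Lambda_m:\mathcal L(\mathcal H_{A_2}^{\otimes m}\otimes\mathcal H_{B_2}^{\otimes m})\to\mathcal L(\mathbb C^2\otimes\mathbb C^2)$, each implemented by finitely many rounds of local operations and classical communication between the two parties, such that $\lim_{m\to\infty}\|\Lambda_m(\rho^{\otimes m})-\phi_2^+\|_1=0$, where $\|\cdot\|_1$ is the trace norm and $\phi_2^+$ is the projector onto $(|00\rangle+|11\rangle)/\sqrt2$. 3. The replacement map $\Lambda(X)=\operatorname{Tr}(X)\rho$ is a quantum channel (completely positive and trace preserving) that is entangling undetected by $\{W_i\}$, i.e. $\operatorname{Tr}(W_iJ(\Lambda))\ge 0$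 for all $i$; and $\Lambda(\sigma)=\rho$ for every state $\sigma$ on $\mathcal H_{A_1}\otimes\mathcal H_{B_1}$. In particular, every state, even a separable one, can be converted to an LOCC-distillable two-qubit entangled state by a channel that is entangling undetected by $\{W_i\}$. -/

import Mathlib

open scoped ComplexOrder Kronecker

/-! Operators on a finite-dimensional Hilbert space with a fixed orthonormal basis indexed by a
finite type `A` are matrices `Matrix A A ℂ`; the tensor product of the spaces with basis indices
`A` and `B` has basis index `A × B`. -/

namespace QInfo

/-- Linear maps `L(H_A) → L(H_C)` (superoperators). -/
abbrev SuperOp (A C : Type) : Type := Matrix A A ℂ →ₗ[ℂ] Matrix C C ℂ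

/-- Density operators (states): positive semidefinite with trace one. -/
def IsState {A : Type} [Fintype A] (ρ : Matrix A A ℂ) : Prop :=
  ρ.PosSemidef ∧ ρ.trace = 1

/-- Separable operators with respect to the cut `A : B`: finite sums `∑ i, τ i ⊗ ω i` with
`τ i`, `ω i` positive semidefinite. -/
def IsSeparable {A B : Type} (σ : Matrix (A × B) (A × B) ℂ) : Prop :=
  ∃ (m : ℕ) (τ : Fin m → Matrix A A ℂ) (ω : Fin m → Matrix B B ℂ),
    (∀ i, (τ i).PosSemidef) ∧ (∀ i, (ω i).PosSemidef) ∧ σ = ∑ i, τ i ⊗ₖ ω i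

/-- Entanglement witnesses with respect to `A : B`: hermitian operators `W` with `Tr (W σ) ≥ 0`
for all separable states `σ`. -/
def IsEntanglementWitness {A B : Type} [Fintype A] [Fintype B]
    (W : Matrix (A × B) (A × B) ℂ) : Prop :=
  W.IsHermitian ∧
    ∀ σ : Matrix (A × B) (A × B) ℂ, IsState σ → IsSeparable σ → 0 ≤ (W * σ).trace

/-- The map `Λ ⊗ id_R`. -/
def tensorIdRight {A C : Type} (R : Type) (Λ : SuperOp A C) : SuperOp (A × R) (C × R) where
  toFun X := Matrix.of fun p q => Λ (Matrix.of fun a a' => X (a, p.2) (a', q.2)) p.1 q.1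
  map_add' X Y := by
    ext p q
    exact congrFun (congrFun (map_add Λ (Matrix.of fun a a' => X (a, p.2) (a', q.2))
      (Matrix.of fun a a' => Y (a, p.2) (a', q.2))) p.1) q.1
  map_smul' c X := by
    ext p q
    exact congrFun (congrFun (map_smul Λ c
      (Matrix.of fun a a' => X (a, p.2) (a', q.2))) p.1) q.1

/-- The map `id_R ⊗ Λ`. -/
def tensorIdLeft {B C : Type} (R : Type) (Λ : SuperOp B C) : SuperOp (R × B) (R × C) where
  toFun X := Matrix.of fun p q => Λ (Matrix.of fun b b' => X (p.1, b) (q.1, b')) p.2 q.2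
  map_add' X Y := by
    ext p q
    exact congrFun (congrFun (map_add Λ (Matrix.of fun b b' => X (p.1, b) (q.1, b'))
      (Matrix.of fun b b' => Y (p.1, b) (q.1, b'))) p.2) q.2
  map_smul' c X := by
    ext p q
    exact congrFun (congrFun (map_smul Λ c
      (Matrix.of fun b b' => X (p.1, b) (q.1, b'))) p.2) q.2

/-- Complete positivity: `Λ ⊗ id_k` is positive for every `k`. -/
def IsCP {A C : Type} (Λ : SuperOp A C) : Prop :=
  ∀ (k : ℕ) (X : Matrix (A × Fin k) (A × Fin k) ℂ),
    X.PosSemidef → (tensorIdRight (Fin k) Λ X).PosSemidef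

/-- Trace preservation. -/
def IsTP {A C : Type} [Fintype A] [Fintype C] (Λ : SuperOp A C) : Prop :=
  ∀ X : Matrix A A ℂ, (Λ X).trace = X.trace

/-- Quantum channels: completely positive and trace preserving linear maps. -/
def IsChannel {A C : Type} [Fintype A] [Fintype C] (Λ : SuperOp A C) : Prop :=
  IsCP Λ ∧ IsTP Λ

/-- The unnormalized maximally entangled operator `∑ i j, |i⟩⟨j| ⊗ |i⟩⟨j|`. -/
def maxEnt (A : Type) [DecidableEq A] : Matrix (A × A) (A × A) ℂ :=
  Matrix.of fun p q => if p.1 = p.2 ∧ q.1 = q.2 then 1 else 0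

/-- The Choi operator `J(Λ) = (Λ ⊗ id) (∑ i j, |i⟩⟨j| ⊗ |i⟩⟨j|)`. -/
def choi {A C : Type} [DecidableEq A] (Λ : SuperOp A C) : Matrix (C × A) (C × A) ℂ :=
  tensorIdRight A Λ (maxEnt A)

/-- Regroups an operator on `(A₂ B₂) ⊗ (A₁ B₁)` as an operator on `(A₂ A₁) ⊗ (B₂ B₁)`. -/
def regroup {A₂ B₂ A₁ B₁ : Type}
    (X : Matrix ((A₂ × B₂) × (A₁ × B₁)) ((A₂ × B₂) × (A₁ × B₁)) ℂ) :
    Matrix ((A₂ × A₁) × (B₂ × B₁)) ((A₂ × A₁) × (B₂ × B₁)) ℂ :=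
  Matrix.of fun p q =>
    X ((p.1.1, p.2.1), (p.1.2, p.2.2)) ((q.1.1, q.2.1), (q.1.2, q.2.2))

/-- `Λ` is entangling undetected by the family `W` of operators on the Choi space:
it is completely positive and `Tr (W i * J(Λ)) ≥ 0` for all `i`. -/
def EntanglingUndetected {A₁ B₁ A₂ B₂ : Type} [Fintype A₁] [Fintype B₁] [Fintype A₂] [Fintype B₂]
    [DecidableEq A₁] [DecidableEq B₁] {n : ℕ}
    (W : Fin n → Matrix ((A₂ × B₂) × (A₁ × B₁)) ((A₂ × B₂) × (A₁ × B₁)) ℂ)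
    (Λ : SuperOp (A₁ × B₁) (A₂ × B₂)) : Prop :=
  IsCP Λ ∧ ∀ i, 0 ≤ (W i * choi Λ).trace

/-- The replacement map `X ↦ Tr(X) ρ`. -/
def replacement {A C : Type} [Fintype A] (ρ : Matrix C C ℂ) : SuperOp A C :=
  (Matrix.traceLinearMap A ℂ ℂ).smulRight ρ

/-- Quantum instruments with finitely many outcomes: completely positive maps whose sum is trace
preserving. -/
def IsInstrument {A C : Type} [Fintype A] [Fintype C] {k : ℕ} (E : Fin k → SuperOp A C) : Prop :=
  (∀ i, IsCP (E i)) ∧ IsTP (∑ i, E i)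

/-- Channels `L(H_A ⊗ H_B) → L(H_A' ⊗ H_B')` that are implemented by a finite protocol of local
operations and classical communication. Such a protocol either does nothing, or begins with one
party applying a local instrument and broadcasting its outcome `i`, after which the parties follow
an LOCC protocol that may depend on `i`. (A local channel is an instrument with one outcome.) -/
inductive IsLOCC {A' B' : Type} :
    (A B : Type) → SuperOp (A × B) (A' × B') → Prop
  | done : IsLOCC A' B' LinearMap.id
  | alice {A B C : Type} [Fintype A] [Fintype C] {k : ℕ} (E : Fin k → SuperOp A C)
      (hE : IsInstrument E) (Λ : Fin k → SuperOp (C × B) (A' × B'))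
      (hΛ : ∀ i, IsLOCC C B (Λ i)) :
      IsLOCC A B (∑ i, (Λ i).comp (tensorIdRight B (E i)))
  | bob {A B C : Type} [Fintype B] [Fintype C] {k : ℕ} (E : Fin k → SuperOp B C)
      (hE : IsInstrument E) (Λ : Fin k → SuperOp (A × C) (A' × B'))
      (hΛ : ∀ i, IsLOCC A C (Λ i)) :
      IsLOCC A B (∑ i, (Λ i).comp (tensorIdLeft A (E i)))

/-- The `n`-fold tensor power `ρ^{⊗ n}` of a bipartite operator, with the `n` systems of the first
party grouped together and the `n` systems of the second party grouped together. -/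
def tensorPow {A B : Type} (ρ : Matrix (A × B) (A × B) ℂ) (n : ℕ) :
    Matrix ((Fin n → A) × (Fin n → B)) ((Fin n → A) × (Fin n → B)) ℂ :=
  Matrix.of fun p q => ∏ i, ρ (p.1 i, p.2 i) (q.1 i, q.2 i)

/-- The trace norm: the sum of the singular values, i.e. of the square roots of the eigenvalues
of `Mᴴ M`. -/
noncomputable def traceNorm {A : Type} [Fintype A] [DecidableEq A] (M : Matrix A A ℂ) : ℝ :=
  ∑ i, Real.sqrt ((Matrix.isHermitian_conjTranspose_mul_self M).eigenvalues i)

/-- The two-qubit maximally entangled state `|φ⟩⟨φ|`, `φ = (|00⟩ + |11⟩) / √2`. -/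
noncomputable def phiPlus : Matrix (Fin 2 × Fin 2) (Fin 2 × Fin 2) ℂ :=
  (1 / 2 : ℂ) • maxEnt (Fin 2)

/-- Distillability under LOCC: there are LOCC channels `Λ n` with
`‖Λ n (ρ^{⊗ n}) - φ⁺‖₁ → 0`. -/
def IsLOCCDistillable {A B : Type} (ρ : Matrix (A × B) (A × B) ℂ) : Prop :=
  ∃ Λ : (n : ℕ) → SuperOp ((Fin n → A) × (Fin n → B)) (Fin 2 × Fin 2),
    (∀ n, IsLOCC (Fin n → A) (Fin n → B) (Λ n)) ∧
    Filter.Tendsto (fun n => traceNorm (Λ n (tensorPow ρ n) - phiPlus)) Filter.atTop (nhds 0)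

/-- `ρ` is a two-qubit state inside `H_A ⊗ H_B`: the image of a state on `ℂ² ⊗ ℂ²` under a tensor
product of local isometries `ℂ² → H_A` and `ℂ² → H_B`. -/
def IsTwoQubitState {A B : Type} [Fintype A] [Fintype B]
    (ρ : Matrix (A × B) (A × B) ℂ) : Prop :=
  ∃ (U : Matrix A (Fin 2) ℂ) (V : Matrix B (Fin 2) ℂ)
    (ρ₀ : Matrix (Fin 2 × Fin 2) (Fin 2 × Fin 2) ℂ),
    U.conjTranspose * U = 1 ∧ V.conjTranspose * V = 1 ∧ IsState ρ₀ ∧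
      ρ = (U ⊗ₖ V) * ρ₀ * (U ⊗ₖ V).conjTranspose

end QInfo

namespace QInfo

open Matrix

/-! The Choi operator of a replacement map is `ρ ⊗ 1`, so `W i` sees `ρ` only through its partial
trace `w i` over `A₁ B₁` (`trace_mul_choi_replacement`). As the identity on `A₁ B₁` is a product, `w
i` is nonnegative on product vectors (`dotProduct_discardRight_nonneg`).

If `w i ≠ 0`, its quadratic form on product vectors is real analytic and not identically zero, hence
nonzero on an open dense set. Finitely many such sets share a point `a ⊗ b`, where every nonzero `w
i` is then strictly positive (`exists_prodVec_forall_ne_zero`). Rotating slightly towards an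
orthogonal product vector keeps the strict inequalities and gives a pure state of Schmidt rank two
(`exists_schmidtState_trace_nonneg`).

That state is entangled by the partial transpose test. It is distillable because one party can
equalize its Schmidt coefficients by a filter; each failure consumes one copy, so the error decays
geometrically (`isLOCCDistillable_of_filter`). -/

/-! ### Completely positive maps, channels and instruments. -/

/-- The superoperator `X ↦ K X Kᴴ`. -/
def conjMap {A C : Type} [Fintype A] (K : Matrix C A ℂ) : SuperOp A C where
  toFun X := K * X * Kᴴ
  map_add' X Y := by rw [Matrix.mul_add, Matrix.add_mul]
  map_smul' c X := by simp

/-- The superoperator `X ↦ ∑ i, X.submatrix (f i) (f i)`; reindexings and partial traces are of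
this form. -/
def sumSubmatrix {ι C D : Type} [Fintype ι] (f : ι → C → D) : SuperOp D C where
  toFun X := ∑ i, X.submatrix (f i) (f i)
  map_add' X Y := Finset.sum_add_distrib
  map_smul' c X := by
    rw [RingHom.id_apply, Finset.smul_sum]
    rfl

theorem sumSubmatrix_apply {ι C D : Type} [Fintype ι] (f : ι → C → D) (X : Matrix D D ℂ)
    (c c' : C) : sumSubmatrix f X c c' = ∑ i, X (f i c) (f i c') := by
  change (∑ i, X.submatrix (f i) (f i)) c c' = _
  simp [Matrix.sum_apply]

/-- `IsCP` tests only ancillas `Fin k`; an enumeration of `R` transports it to any finite ancilla.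
-/
theorem IsCP.posSemidef_tensorIdRight {A C R : Type} [Fintype R] {Λ : SuperOp A C} (h : IsCP Λ)
    {X : Matrix (A × R) (A × R) ℂ} (hX : X.PosSemidef) : (tensorIdRight R Λ X).PosSemidef := by
  have e := Fintype.equivFin R
  have h1 := (h _ _ (hX.submatrix (Prod.map id e.symm))).submatrix (Prod.map id e)
  convert h1 using 1
  ext p q
  simp [tensorIdRight]

theorem IsCP.add {A C : Type} {Λ Γ : SuperOp A C} (hΛ : IsCP Λ) (hΓ : IsCP Γ) : IsCP (Λ + Γ) :=
  fun k X hX => (hΛ k X hX).add (hΓ k X hX)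

theorem IsCP.comp {A B C : Type} {Λ : SuperOp B C} {Γ : SuperOp A B} (hΛ : IsCP Λ)
    (hΓ : IsCP Γ) : IsCP (Λ.comp Γ) :=
  fun k X hX => hΛ k _ (hΓ k X hX)

theorem IsTP.comp {A B C : Type} [Fintype A] [Fintype B] [Fintype C] {Λ : SuperOp B C}
    {Γ : SuperOp A B} (hΛ : IsTP Λ) (hΓ : IsTP Γ) : IsTP (Λ.comp Γ) :=
  fun X => (hΛ _).trans (hΓ X)

theorem IsChannel.comp {A B C : Type} [Fintype A] [Fintype B] [Fintype C] {Λ : SuperOp B C}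
    {Γ : SuperOp A B} (hΛ : IsChannel Λ) (hΓ : IsChannel Γ) : IsChannel (Λ.comp Γ) :=
  ⟨hΛ.1.comp hΓ.1, hΛ.2.comp hΓ.2⟩

theorem tensorIdRight_conjMap {A C R : Type} [Fintype A] [Fintype R] [DecidableEq R]
    (K : Matrix C A ℂ) (X : Matrix (A × R) (A × R) ℂ) :
    tensorIdRight R (conjMap K) X
      = (K ⊗ₖ (1 : Matrix R R ℂ)) * X * (K ⊗ₖ (1 : Matrix R R ℂ))ᴴ := by
  ext ⟨c, r⟩ ⟨c', r'⟩
  simp [tensorIdRight, conjMap, Matrix.mul_apply, Fintype.sum_prod_type, Matrix.one_apply,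
    apply_ite]

theorem isCP_conjMap {A C : Type} [Fintype A] [Fintype C] (K : Matrix C A ℂ) : IsCP (conjMap K) := by
  classical
  intro k X hX
  rw [tensorIdRight_conjMap]
  exact hX.mul_mul_conjTranspose_same _

theorem isCP_sumSubmatrix {ι C D : Type} [Fintype ι] (f : ι → C → D) :
    IsCP (sumSubmatrix f) := by
  intro k X hX
  convert posSemidef_sum Finset.univ fun i _ => hX.submatrix (Prod.map (f i) (id : Fin k → Fin k))
    using 1
  ext p q
  simp [tensorIdRight, sumSubmatrix_apply, Matrix.sum_apply, Prod.map]

/-- The bijection identifies `D` with `ι × C`, which makes the map the partial trace over `ι`. -/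
theorem isChannel_sumSubmatrix {ι C D : Type} [Fintype ι] [Fintype C] [Fintype D]
    (f : ι → C → D) (hf : Function.Bijective fun p : ι × C => f p.1 p.2) :
    IsChannel (sumSubmatrix f) := by
  refine ⟨isCP_sumSubmatrix f, fun X => ?_⟩
  simp only [Matrix.trace, Matrix.diag_apply, sumSubmatrix_apply]
  rw [Finset.sum_comm, ← Fintype.sum_prod_type']
  exact (Equiv.ofBijective _ hf).sum_comp fun d => X d d

theorem isCP_replacement {A C : Type} [Fintype A] [Fintype C] {σ : Matrix C C ℂ}
    (hσ : σ.PosSemidef) : IsCP (replacement (A := A) σ) := by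
  intro k X hX
  have h : tensorIdRight (Fin k) (replacement σ) X
      = σ ⊗ₖ ∑ a : A, X.submatrix (fun r : Fin k => (a, r)) fun r => (a, r) := by
    ext p q
    simp [tensorIdRight, replacement, Matrix.trace, Matrix.sum_apply, mul_comm]
  rw [h]
  exact hσ.kronecker (posSemidef_sum Finset.univ fun a _ => hX.submatrix fun r : Fin k => (a, r))

theorem isChannel_replacement {A C : Type} [Fintype A] [Fintype C] {σ : Matrix C C ℂ}
    (hσ : IsState σ) : IsChannel (replacement (A := A) σ) :=
  ⟨isCP_replacement hσ.1, fun X => by simp [replacement, hσ.2]⟩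

theorem isState_single {C : Type} [Fintype C] [DecidableEq C] (c : C) :
    IsState (Matrix.single c c (1 : ℂ)) := by
  refine ⟨?_, by simp⟩
  rw [← Matrix.diagonal_single]
  exact PosSemidef.diagonal (by simp [Pi.single_nonneg])

open scoped MatrixOrder Matrix.Norms.L2Operator in
/-- A Kraus operator `K` with `Kᴴ K ≤ 1` is part of an instrument whose other outcome
vanishes on the operators annihilated by `1 - Kᴴ K`. -/
theorem exists_isTP_conjMap_add {A C : Type} [Fintype A] [DecidableEq A] [Fintype C] [Nonempty C]
    (K : Matrix C A ℂ) (hK : (1 - Kᴴ * K).PosSemidef) :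
    ∃ F : SuperOp A C, IsCP F ∧ IsTP (conjMap K + F) ∧
      ∀ X, (1 - Kᴴ * K) * X = 0 → F X = 0 := by
  classical
  obtain ⟨c⟩ := ‹Nonempty C›
  -- With `Qᴴ Q = 1 - Kᴴ K`, the second outcome applies `Q` and then prepares a fixed basis state,
  -- so that it has the same output space as `K`.
  obtain ⟨Q, hQ⟩ := CStarAlgebra.nonneg_iff_eq_star_mul_self.mp hK.nonneg
  rw [star_eq_conjTranspose] at hQ
  refine ⟨(replacement (Matrix.single c c 1)).comp (conjMap Q),
    (isCP_replacement (isState_single c).1).comp (isCP_conjMap Q), fun X => ?_,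
    fun X hX => ?_⟩
  rotate_left
  · have h1 : (Q * X * Qᴴ).trace = 0 := by
      rw [Matrix.trace_mul_cycle, ← hQ, hX, Matrix.trace_zero]
    simp [conjMap, replacement, h1]
  have h1 : ((conjMap K + (replacement (Matrix.single c c 1)).comp (conjMap Q)) X).trace
      = (K * X * Kᴴ).trace + (Q * X * Qᴴ).trace := by
    simp [conjMap, replacement]
  rw [h1, Matrix.trace_mul_cycle, Matrix.trace_mul_cycle Q, ← Matrix.trace_add, ← Matrix.add_mul,
    ← hQ]
  simp

theorem isCP_tensorIdRight {A C R : Type} [Fintype R] {Λ : SuperOp A C} (hΛ : IsCP Λ) :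
    IsCP (tensorIdRight R Λ) := by
  intro k X hX
  have h := hΛ.posSemidef_tensorIdRight
    (hX.submatrix (Equiv.prodAssoc A R (Fin k)).symm)
  exact h.submatrix (Equiv.prodAssoc C R (Fin k))

theorem isTP_tensorIdRight {A C R : Type} [Fintype A] [Fintype C] [Fintype R] {Λ : SuperOp A C}
    (hΛ : IsTP Λ) : IsTP (tensorIdRight R Λ) := by
  intro X
  simp only [Matrix.trace, Matrix.diag_apply, Fintype.sum_prod_type_right]
  exact Finset.sum_congr rfl fun r _ => hΛ (Matrix.of fun a a' => X (a, r) (a', r))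

/-! ### LOCC steps acting on one copy of a tensor power. -/

theorem IsLOCC.alice_channel {A B C A' B' : Type} [Fintype A] [Fintype C] {E : SuperOp A C}
    (hE : IsChannel E) {Λ : SuperOp (C × B) (A' × B')} (hΛ : IsLOCC C B Λ) :
    IsLOCC A B (Λ.comp (tensorIdRight B E)) := by
  simpa using IsLOCC.alice (k := 1) (fun _ => E) ⟨fun _ => hE.1, by simpa using hE.2⟩
    (fun _ => Λ) fun _ => hΛ

theorem IsLOCC.bob_channel {A B C A' B' : Type} [Fintype B] [Fintype C] {E : SuperOp B C}
    (hE : IsChannel E) {Λ : SuperOp (A × C) (A' × B')} (hΛ : IsLOCC A C Λ) :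
    IsLOCC A B (Λ.comp (tensorIdLeft A E)) := by
  simpa using IsLOCC.bob (k := 1) (fun _ => E) ⟨fun _ => hE.1, by simpa using hE.2⟩
    (fun _ => Λ) fun _ => hΛ

theorem bijective_finCons (A : Type) (m : ℕ) :
    Function.Bijective fun p : A × (Fin m → A) => (Fin.cons p.1 p.2 : Fin (m + 1) → A) :=
  ⟨fun _ _ h => Prod.ext_iff.mpr (Fin.cons_inj.mp h),
    fun x => ⟨(x 0, Fin.tail x), Fin.cons_self_tail x⟩⟩

/-- Applies `Λ` to the first of `m + 1` systems. -/
def onHead {A C : Type} (m : ℕ) (Λ : SuperOp A C) :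
    SuperOp (Fin (m + 1) → A) (C × (Fin m → A)) :=
  (tensorIdRight (Fin m → A) Λ).comp
    (sumSubmatrix fun (_ : Unit) (p : A × (Fin m → A)) => (Fin.cons p.1 p.2 : Fin (m + 1) → A))

/-- Discards all but the first of `m + 1` systems. -/
def discardTail (A : Type) [Fintype A] (m : ℕ) : SuperOp (Fin (m + 1) → A) A :=
  sumSubmatrix fun (t : Fin m → A) (a : A) => (Fin.cons a t : Fin (m + 1) → A)

/-- Discards the first of `m + 1` systems. -/
def discardHead (A : Type) [Fintype A] (m : ℕ) : SuperOp (Fin (m + 1) → A) (Fin m → A) :=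
  sumSubmatrix fun (a : A) (t : Fin m → A) => (Fin.cons a t : Fin (m + 1) → A)

/-- The partial trace over the second tensor factor. -/
def discardRight (A B : Type) [Fintype B] : SuperOp (A × B) A :=
  sumSubmatrix fun (b : B) (a : A) => (a, b)

/-- The partial trace over the first tensor factor. -/
def discardLeft (A B : Type) [Fintype A] : SuperOp (A × B) B :=
  sumSubmatrix fun (a : A) (b : B) => (a, b)

theorem isChannel_discardTail (A : Type) [Fintype A] (m : ℕ) : IsChannel (discardTail A m) :=
  isChannel_sumSubmatrix _ ((bijective_finCons A m).comp (Equiv.prodComm _ _).bijective)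

theorem isChannel_discardHead (A : Type) [Fintype A] (m : ℕ) : IsChannel (discardHead A m) :=
  isChannel_sumSubmatrix _ (bijective_finCons A m)

theorem isChannel_discardRight (A B : Type) [Fintype A] [Fintype B] :
    IsChannel (discardRight A B) :=
  isChannel_sumSubmatrix _ (Equiv.prodComm _ _).bijective

theorem isChannel_discardLeft (A B : Type) [Fintype A] [Fintype B] :
    IsChannel (discardLeft A B) :=
  isChannel_sumSubmatrix _ Function.bijective_id

theorem isCP_onHead {A C : Type} [Fintype A] (m : ℕ) {Λ : SuperOp A C} (hΛ : IsCP Λ) :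
    IsCP (onHead m Λ) :=
  (isCP_tensorIdRight hΛ).comp (isCP_sumSubmatrix _)

theorem isTP_onHead {A C : Type} [Fintype A] [Fintype C] (m : ℕ) {Λ : SuperOp A C}
    (hΛ : IsTP Λ) : IsTP (onHead m Λ) :=
  (isTP_tensorIdRight hΛ).comp
    (isChannel_sumSubmatrix (fun (_ : Unit) (p : A × (Fin m → A)) =>
        (Fin.cons p.1 p.2 : Fin (m + 1) → A))
      ((bijective_finCons A m).comp (Equiv.punitProd (A × (Fin m → A))).bijective)).2

theorem onHead_apply {A C : Type} (m : ℕ) (Λ : SuperOp A C)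
    (X : Matrix (Fin (m + 1) → A) (Fin (m + 1) → A) ℂ) (c c' : C) (t t' : Fin m → A) :
    onHead m Λ X (c, t) (c', t')
      = Λ (Matrix.of fun a a' => X (Fin.cons a t) (Fin.cons a' t')) c c' := by
  simp [onHead, tensorIdRight, sumSubmatrix_apply]

theorem tensorIdRight_onHead_tensorPow {A B C : Type} (m : ℕ) (Λ : SuperOp A C)
    (ρ : Matrix (A × B) (A × B) ℂ) (c c' : C) (t t' : Fin m → A) (b b' : B) (s s' : Fin m → B) :
    tensorIdRight (Fin (m + 1) → B) (onHead m Λ) (tensorPow ρ (m + 1))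
        ((c, t), Fin.cons b s) ((c', t'), Fin.cons b' s')
      = tensorIdRight B Λ ρ (c, b) (c', b') * tensorPow ρ m (t, s) (t', s') := by
  have h : (Matrix.of fun a a' => tensorPow ρ (m + 1) (Fin.cons a t, Fin.cons b s)
      (Fin.cons a' t', Fin.cons b' s'))
      = tensorPow ρ m (t, s) (t', s') • Matrix.of fun a a' => ρ (a, b) (a', b') := by
    ext a a'
    simp [tensorPow, Fin.prod_univ_succ, mul_comm]
  have h2 := congrFun (congrFun (congrArg Λ h) c) c'
  rw [map_smul, Matrix.smul_apply, smul_eq_mul, mul_comm] at h2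
  exact (onHead_apply m Λ _ c c' t t').trans h2

theorem trace_tensorPow {A B : Type} [Fintype A] [Fintype B] (ρ : Matrix (A × B) (A × B) ℂ)
    (m : ℕ) : (tensorPow ρ m).trace = ρ.trace ^ m := by
  have h := Fintype.prod_sum fun (_ : Fin m) (x : A × B) => ρ x x
  rw [Finset.prod_const, Finset.card_univ, Fintype.card_fin] at h
  refine Eq.trans ?_ h.symm
  exact (Equiv.sum_comp (Equiv.arrowProdEquivProdArrow (Fin m) (fun _ => A) fun _ => B)
    fun p => tensorPow ρ m p p).symm

/-- The success branch: the filtered pair is kept and the unused copies are traced out, contributing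
the factor `ρ.trace ^ m = 1`. -/
theorem distill_success {A B C D : Type} [Fintype A] [Fintype B] [Fintype C] [Fintype D]
    (m : ℕ) (E : SuperOp A C) (F : SuperOp B D) (ρ : Matrix (A × B) (A × B) ℂ)
    (hρ : ρ.trace = 1) :
    tensorIdRight D (discardRight C (Fin m → A))
      (tensorIdLeft (C × (Fin m → A)) (F.comp (discardTail B m))
        (tensorIdRight (Fin (m + 1) → B) (onHead m E) (tensorPow ρ (m + 1))))
      = tensorIdLeft C F (tensorIdRight B E ρ) := by
  have key (c c' : C) (t : Fin m → A) :
      discardTail B m (Matrix.of fun b b' => tensorIdRight (Fin (m + 1) → B) (onHead m E)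
        (tensorPow ρ (m + 1)) ((c, t), b) ((c', t), b'))
      = (∑ s, tensorPow ρ m (t, s) (t, s)) •
        Matrix.of fun b b' => tensorIdRight B E ρ (c, b) (c', b') := by
    ext b b'
    simp only [discardTail, sumSubmatrix_apply, Matrix.of_apply, Matrix.smul_apply, smul_eq_mul,
      tensorIdRight_onHead_tensorPow, Finset.mul_sum, mul_comm]
  have htr : ∑ t, ∑ s, tensorPow ρ m (t, s) (t, s) = 1 := by
    rw [← one_pow m, ← hρ, ← trace_tensorPow, Matrix.trace, Fintype.sum_prod_type]
    rfl
  ext ⟨c, d⟩ ⟨c', d'⟩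
  have h (X) : tensorIdRight D (discardRight C (Fin m → A))
      (tensorIdLeft (C × (Fin m → A)) (F.comp (discardTail B m)) X) (c, d) (c', d')
      = ∑ t, F (discardTail B m (Matrix.of fun b b' => X ((c, t), b) ((c', t), b'))) d d' := by
    simp [tensorIdRight, tensorIdLeft, discardRight, sumSubmatrix_apply]
  rw [h]
  simp only [key, map_smul, Matrix.smul_apply, ← Finset.sum_smul, htr, one_smul]
  rfl

/-- The failure branch: only the consumed pair is discarded, leaving intact copies weighted by the
probability of the outcome. -/
theorem distill_failure {A B C : Type} [Fintype A] [Fintype B] [Fintype C]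
    (m : ℕ) (E : SuperOp A C) (ρ : Matrix (A × B) (A × B) ℂ) :
    tensorIdRight (Fin m → B) (discardLeft C (Fin m → A))
      (tensorIdLeft (C × (Fin m → A)) (discardHead B m)
        (tensorIdRight (Fin (m + 1) → B) (onHead m E) (tensorPow ρ (m + 1))))
      = (tensorIdRight B E ρ).trace • tensorPow ρ m := by
  ext ⟨t, s⟩ ⟨t', s'⟩
  have h (X) : tensorIdRight (Fin m → B) (discardLeft C (Fin m → A))
      (tensorIdLeft (C × (Fin m → A)) (discardHead B m) X) (t, s) (t', s')
      = ∑ c, ∑ b, X ((c, t), Fin.cons b s) ((c, t'), Fin.cons b s') := by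
    simp [tensorIdRight, tensorIdLeft, discardLeft, discardHead, sumSubmatrix_apply]
  rw [h]
  simp only [tensorIdRight_onHead_tensorPow, ← Finset.sum_mul]
  simp [Matrix.trace, Fintype.sum_prod_type]

/-! ### Trace norm convergence. -/

theorem traceNorm_nonneg {A : Type} [Fintype A] [DecidableEq A] (M : Matrix A A ℂ) :
    0 ≤ traceNorm M :=
  Finset.sum_nonneg fun _ _ => Real.sqrt_nonneg _

/-- Cauchy–Schwarz on the singular values. The bound is visibly continuous in `M`, so entrywise
convergence suffices later. -/
theorem traceNorm_le {A : Type} [Fintype A] [DecidableEq A] (M : Matrix A A ℂ) :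
    traceNorm M ≤ √(Fintype.card A * (Mᴴ * M).trace.re) := by
  have h0 := (posSemidef_conjTranspose_mul_self M).eigenvalues_nonneg
  have h1 : (Mᴴ * M).trace.re = ∑ i, (isHermitian_conjTranspose_mul_self M).eigenvalues i := by
    simp [(isHermitian_conjTranspose_mul_self M).trace_eq_sum_eigenvalues]
  rw [h1, traceNorm]
  refine Real.le_sqrt_of_sq_le ?_
  refine (sq_sum_le_card_mul_sum_sq).trans_eq ?_
  simp [Real.sq_sqrt (h0 _)]

theorem tendsto_traceNorm_zero {A : Type} [Fintype A] [DecidableEq A] {M : ℕ → Matrix A A ℂ}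
    (hM : Filter.Tendsto M Filter.atTop (nhds 0)) :
    Filter.Tendsto (fun n => traceNorm (M n)) Filter.atTop (nhds 0) := by
  have hc : Continuous fun X : Matrix A A ℂ => √(Fintype.card A * (Xᴴ * X).trace.re) := by
    fun_prop
  refine squeeze_zero (fun n => traceNorm_nonneg _) (fun n => traceNorm_le _) ?_
  simpa [Function.comp_def] using (hc.tendsto 0).comp hM

/-! ### Distillation by repeated filtering. -/

theorem isTP_tensorIdLeft {B C R : Type} [Fintype B] [Fintype C] [Fintype R] {Λ : SuperOp B C}
    (hΛ : IsTP Λ) : IsTP (tensorIdLeft R Λ) := by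
  intro X
  simp only [Matrix.trace, Matrix.diag_apply, Fintype.sum_prod_type]
  exact Finset.sum_congr rfl fun r _ => hΛ (Matrix.of fun b b' => X (r, b) (r, b'))

theorem IsLOCC.alice_filter {A B C A' B' : Type} [Fintype A] [Fintype C] {E₁ E₀ : SuperOp A C}
    {Λ₁ Λ₀ : SuperOp (C × B) (A' × B')} (hΛ₁ : IsLOCC C B Λ₁) (hΛ₀ : IsLOCC C B Λ₀)
    (hE₁ : IsCP E₁) (hE₀ : IsCP E₀) (hE : IsTP (E₁ + E₀)) :
    IsLOCC A B (Λ₁.comp (tensorIdRight B E₁) + Λ₀.comp (tensorIdRight B E₀)) := by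
  simpa using IsLOCC.alice ![E₁, E₀]
    ⟨Fin.forall_fin_two.mpr ⟨hE₁, hE₀⟩, by simpa using hE⟩ ![Λ₁, Λ₀]
    (Fin.forall_fin_two.mpr ⟨hΛ₁, hΛ₀⟩)

/-- A state which a local filter on one side and a local channel on the other side turn into the
maximally entangled state with nonzero probability is distillable. -/
theorem isLOCCDistillable_of_filter {A B : Type} [Fintype A] [Fintype B]
    {ρ : Matrix (A × B) (A × B) ℂ} (hρ : ρ.trace = 1) {E₀ E₁ : SuperOp A (Fin 2)}
    (hE₀ : IsCP E₀) (hE₁ : IsCP E₁) (hE : IsTP (E₁ + E₀)) {F : SuperOp B (Fin 2)}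
    (hF : IsChannel F) {p : ℂ} (hp : ‖1 - p‖ < 1)
    (h : tensorIdLeft (Fin 2) F (tensorIdRight B E₁ ρ) = p • phiPlus) :
    IsLOCCDistillable ρ := by
  have htr : phiPlus.trace = 1 := by
    simp [phiPlus, maxEnt, Matrix.trace, Fintype.sum_prod_type]
  have htr₁ : (tensorIdRight B E₁ ρ).trace = p := by
    rw [← isTP_tensorIdLeft (R := Fin 2) hF.2, h, Matrix.trace_smul, htr, smul_eq_mul, mul_one]
  have htr₀ : (tensorIdRight B E₀ ρ).trace = 1 - p := by
    have h1 : (tensorIdRight B E₁ ρ + tensorIdRight B E₀ ρ).trace = ρ.trace :=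
      isTP_tensorIdRight hE ρ
    rw [Matrix.trace_add, htr₁, hρ] at h1
    exact eq_sub_of_add_eq' h1
  have hσ := isChannel_replacement (A := Fin 0 → A) (isState_single (0 : Fin 2))
  have hσ' := isChannel_replacement (A := Fin 0 → B) (isState_single (0 : Fin 2))
  -- `D` is the error with no copies left, when both parties just prepare `|0⟩`. One more copy turns
  -- the output into `p φ + (1 - p)(φ + (1 - p)^m D)`, with `φ` for `phiPlus`.
  obtain ⟨D, hD⟩ : ∃ D : Matrix (Fin 2 × Fin 2) (Fin 2 × Fin 2) ℂ, ∀ m : ℕ,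
      ∃ Λ : SuperOp ((Fin m → A) × (Fin m → B)) (Fin 2 × Fin 2),
        IsLOCC (Fin m → A) (Fin m → B) Λ ∧
        Λ (tensorPow ρ m) = phiPlus + (1 - p) ^ m • D := by
    refine ⟨((LinearMap.id.comp (tensorIdLeft (Fin 2) (replacement (Matrix.single 0 0 1)))).comp
      (tensorIdRight (Fin 0 → B) (replacement (Matrix.single 0 0 1)))) (tensorPow ρ 0) - phiPlus,
      fun m => ?_⟩
    induction m with
    | zero => exact ⟨_, (IsLOCC.done.bob_channel hσ').alice_channel hσ, by simp⟩
    | succ m ih =>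
      obtain ⟨Λ, hΛ, hΛρ⟩ := ih
      have hs : IsLOCC (Fin 2 × (Fin m → A)) (Fin (m + 1) → B) _ :=
        (IsLOCC.done.alice_channel (isChannel_discardRight (Fin 2) (Fin m → A))).bob_channel
          (hF.comp (isChannel_discardTail B m))
      have hf : IsLOCC (Fin 2 × (Fin m → A)) (Fin (m + 1) → B) _ :=
        (hΛ.alice_channel (isChannel_discardLeft (Fin 2) (Fin m → A))).bob_channel
          (isChannel_discardHead B m)
      refine ⟨_, hs.alice_filter hf (isCP_onHead m hE₁) (isCP_onHead m hE₀) (isTP_onHead m hE), ?_⟩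
      simp only [LinearMap.add_apply, LinearMap.comp_apply, LinearMap.id_apply]
      rw [distill_success m E₁ F ρ hρ, distill_failure, htr₀, h, map_smul, hΛρ, pow_succ]
      module
  choose Λ hΛ hΛρ using hD
  refine ⟨Λ, hΛ, tendsto_traceNorm_zero ?_⟩
  simp only [hΛρ, add_sub_cancel_left]
  simpa using (tendsto_pow_atTop_nhds_zero_of_norm_lt_one hp).smul_const D

/-! ### Pure states of Schmidt rank two: entanglement and distillability. -/

/-- The projector onto the vector `x₀ |00⟩ + x₁ |11⟩` with real Schmidt coefficients. -/
def schmidtState (x : Fin 2 → ℝ) : Matrix (Fin 2 × Fin 2) (Fin 2 × Fin 2) ℂ :=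
  Matrix.of fun p q => if p.1 = p.2 ∧ q.1 = q.2 then (x p.1 : ℂ) * x q.1 else 0

theorem isState_schmidtState {x : Fin 2 → ℝ} (hx : x 0 ^ 2 + x 1 ^ 2 = 1) :
    IsState (schmidtState x) := by
  constructor
  · convert posSemidef_vecMulVec_self_star
      (fun p : Fin 2 × Fin 2 => if p.1 = p.2 then (x p.1 : ℂ) else 0) using 1
    ext p q
    by_cases hp : p.1 = p.2 <;> by_cases hq : q.1 = q.2 <;>
      simp [schmidtState, vecMulVec_apply, hp, hq]
  · have h : ((x 0 ^ 2 + x 1 ^ 2 : ℝ) : ℂ) = 1 := by rw [hx, Complex.ofReal_one]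
    push_cast at h
    simpa [Matrix.trace, Fintype.sum_prod_type, schmidtState, sq] using h

theorem kronecker_isometry {A B : Type} [Fintype A] [Fintype B] {U : Matrix A (Fin 2) ℂ}
    {V : Matrix B (Fin 2) ℂ} (hU : Uᴴ * U = 1) (hV : Vᴴ * V = 1) :
    (U ⊗ₖ V)ᴴ * (U ⊗ₖ V) = 1 := by
  rw [conjTranspose_kronecker, ← mul_kronecker_mul, hU, hV, one_kronecker_one]

theorem IsState.isometry_conj {A C : Type} [Fintype A] [Fintype C] [DecidableEq C]
    {σ : Matrix C C ℂ} (hσ : IsState σ) {T : Matrix A C ℂ} (hT : Tᴴ * T = 1) :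
    IsState (T * σ * Tᴴ) := by
  refine ⟨hσ.1.mul_mul_conjTranspose_same T, ?_⟩
  rw [Matrix.trace_mul_cycle, hT, Matrix.one_mul, hσ.2]

theorem IsSeparable.kronecker_conj {A B C D : Type} [Fintype A] [Fintype B] [Fintype C] [Fintype D]
    {σ : Matrix (A × B) (A × B) ℂ} (hσ : IsSeparable σ) (K : Matrix C A ℂ) (L : Matrix D B ℂ) :
    IsSeparable ((K ⊗ₖ L) * σ * (K ⊗ₖ L)ᴴ) := by
  obtain ⟨m, τ, ω, hτ, hω, rfl⟩ := hσ
  refine ⟨m, fun i => K * τ i * Kᴴ, fun i => L * ω i * Lᴴ,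
    fun i => (hτ i).mul_mul_conjTranspose_same K, fun i => (hω i).mul_mul_conjTranspose_same L, ?_⟩
  simp only [Matrix.mul_sum, Matrix.sum_mul, conjTranspose_kronecker, ← mul_kronecker_mul]

/-- The partial transpose of a separable operator is positive semidefinite. -/
theorem IsSeparable.posSemidef_partialTranspose {A B : Type} [Fintype A] [Fintype B]
    {σ : Matrix (A × B) (A × B) ℂ} (hσ : IsSeparable σ) :
    (Matrix.of fun p q : A × B => σ (p.1, q.2) (q.1, p.2)).PosSemidef := by
  obtain ⟨m, τ, ω, hτ, hω, rfl⟩ := hσ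
  have h : (Matrix.of fun p q : A × B => (∑ i, τ i ⊗ₖ ω i) (p.1, q.2) (q.1, p.2))
      = ∑ i, τ i ⊗ₖ (ω i)ᵀ := by
    ext p q
    simp [Matrix.sum_apply]
  rw [h]
  exact posSemidef_sum _ fun i _ => (hτ i).kronecker (hω i).transpose

/-- The partial transpose has the negative value `-2 x₀ x₁` on `|01⟩ - |10⟩`. -/
theorem not_isSeparable_schmidtState {x : Fin 2 → ℝ} (h0 : 0 < x 0) (h1 : 0 < x 1) :
    ¬ IsSeparable (schmidtState x) := by
  intro h
  have h2 := h.posSemidef_partialTranspose.dotProduct_mulVec_nonneg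
    (fun p => if p = (0, 1) then 1 else if p = (1, 0) then -1 else 0)
  have h3 : (0 : ℂ) ≤ ((-(2 * (x 0 * x 1)) : ℝ) : ℂ) := by
    convert h2 using 1
    simp [dotProduct, mulVec, Fintype.sum_prod_type, schmidtState]
    ring
  rw [Complex.zero_le_real] at h3
  nlinarith [mul_pos h0 h1]

theorem not_isSeparable_isometry_conj {A B : Type} [Fintype A] [Fintype B]
    {U : Matrix A (Fin 2) ℂ} {V : Matrix B (Fin 2) ℂ} (hU : Uᴴ * U = 1) (hV : Vᴴ * V = 1)
    {σ : Matrix (Fin 2 × Fin 2) (Fin 2 × Fin 2) ℂ} (hσ : ¬ IsSeparable σ) :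
    ¬ IsSeparable ((U ⊗ₖ V) * σ * (U ⊗ₖ V)ᴴ) := by
  intro h
  have h1 := h.kronecker_conj Uᴴ Vᴴ
  have hT := kronecker_isometry hU hV
  rw [← conjTranspose_kronecker, conjTranspose_conjTranspose, Matrix.mul_assoc, Matrix.mul_assoc,
    hT, Matrix.mul_one, ← Matrix.mul_assoc, hT, Matrix.one_mul] at h1
  exact hσ h1

theorem posSemidef_one_sub_isometry {A : Type} [Fintype A] [DecidableEq A]
    {U : Matrix A (Fin 2) ℂ} (hU : Uᴴ * U = 1) : (1 - U * Uᴴ).PosSemidef := by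
  have h : 1 - U * Uᴴ = (1 - U * Uᴴ)ᴴ * (1 - U * Uᴴ) := by
    have h2 : U * Uᴴ * (U * Uᴴ) = U * Uᴴ := by
      rw [Matrix.mul_assoc, ← Matrix.mul_assoc Uᴴ, hU, Matrix.one_mul]
    simp [Matrix.mul_sub, Matrix.sub_mul, h2]
  rw [h]
  exact posSemidef_conjTranspose_mul_self _

/-- The defect splits into the projection `1 - U Uᴴ` off the range of `U` and a term with weights `1
- y i ^ 2` on that range. -/
theorem posSemidef_one_sub_filter {A : Type} [Fintype A] [DecidableEq A]
    {U : Matrix A (Fin 2) ℂ} (hU : Uᴴ * U = 1) {y : Fin 2 → ℝ} (hy : ∀ i, y i ^ 2 ≤ 1) :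
    (1 - (diagonal (fun i => (y i : ℂ)) * Uᴴ)ᴴ * (diagonal (fun i => (y i : ℂ)) * Uᴴ)).PosSemidef
    := by
  have h : 1 - (diagonal (fun i => (y i : ℂ)) * Uᴴ)ᴴ * (diagonal (fun i => (y i : ℂ)) * Uᴴ)
      = (1 - U * Uᴴ) + U * diagonal (fun i => ((1 - y i ^ 2 : ℝ) : ℂ)) * Uᴴ := by
    have h2 : diagonal (fun i => ((1 - y i ^ 2 : ℝ) : ℂ))
        = 1 - diagonal (fun i => (y i : ℂ)) * diagonal (fun i => (y i : ℂ)) := by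
      rw [diagonal_mul_diagonal, ← diagonal_one, diagonal_sub]
      simp [sq]
    have h3 : (diagonal (fun i => (y i : ℂ)))ᴴ = diagonal (fun i => (y i : ℂ)) := by
      rw [diagonal_conjTranspose]
      congr 1
      ext i
      simp
    rw [h2, conjTranspose_mul, conjTranspose_conjTranspose, h3]
    simp only [Matrix.mul_sub, Matrix.sub_mul, Matrix.mul_one, Matrix.mul_assoc]
    abel
  rw [h]
  refine (posSemidef_one_sub_isometry hU).add (PosSemidef.mul_mul_conjTranspose_same ?_ U)
  refine PosSemidef.diagonal fun i => ?_
  exact Complex.zero_le_real.mpr (sub_nonneg.mpr (hy i))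

theorem tensorIdLeft_kronecker_conj {B C R : Type} [Fintype B] [Fintype C] [Fintype R]
    [DecidableEq R] {V : Matrix B C ℂ} {F : SuperOp B C} (hF : ∀ Y, F (V * Y * Vᴴ) = Y)
    (Z : Matrix (R × C) (R × C) ℂ) :
    tensorIdLeft R F (((1 : Matrix R R ℂ) ⊗ₖ V) * Z * ((1 : Matrix R R ℂ) ⊗ₖ V)ᴴ) = Z := by
  ext ⟨r, c⟩ ⟨r', c'⟩
  have h : (Matrix.of fun b b' => (((1 : Matrix R R ℂ) ⊗ₖ V) * Z * ((1 : Matrix R R ℂ) ⊗ₖ V)ᴴ)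
      (r, b) (r', b')) = V * (Matrix.of fun d d' => Z (r, d) (r', d')) * Vᴴ := by
    ext b b'
    simp [Matrix.mul_apply, Fintype.sum_prod_type, Matrix.one_apply, apply_ite, ite_mul]
  have h2 := congrFun (congrFun ((congrArg F h).trans (hF _)) c) c'
  exact h2

theorem isLOCCDistillable_schmidtState {A B : Type} [Fintype A] [Fintype B]
    {U : Matrix A (Fin 2) ℂ} {V : Matrix B (Fin 2) ℂ} (hU : Uᴴ * U = 1) (hV : Vᴴ * V = 1)
    {x : Fin 2 → ℝ} (h0 : 0 < x 0) (h1 : 0 < x 1) (hx : x 0 ^ 2 + x 1 ^ 2 = 1) :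
    IsLOCCDistillable ((U ⊗ₖ V) * schmidtState x * (U ⊗ₖ V)ᴴ) := by
  classical
  have hρ := (isState_schmidtState hx).isometry_conj (kronecker_isometry hU hV)
  -- The filter carries the Schmidt coefficients swapped: both components end up with amplitude `x 0
  -- * x 1`.
  obtain ⟨E₀, hE₀, hE, -⟩ := exists_isTP_conjMap_add _
    (posSemidef_one_sub_filter hU (y := fun i => x (1 - i))
      (Fin.forall_fin_two.mpr ⟨by change x 1 ^ 2 ≤ 1; nlinarith, by change x 0 ^ 2 ≤ 1; nlinarith⟩))
  -- `Vᴴ` alone need not preserve trace; the completion `G` vanishes on operators supported on the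
  -- range of `V`, so the resulting channel still undoes `V` exactly.
  obtain ⟨G, hG, hFG, hG0⟩ := exists_isTP_conjMap_add Vᴴ
    (by simpa using posSemidef_one_sub_isometry hV)
  have hF (Y : Matrix (Fin 2) (Fin 2) ℂ) : (conjMap Vᴴ + G) (V * Y * Vᴴ) = Y := by
    have h2 : G (V * Y * Vᴴ) = 0 := by
      refine hG0 _ ?_
      rw [conjTranspose_conjTranspose, Matrix.sub_mul, Matrix.one_mul, sub_eq_zero]
      simp only [Matrix.mul_assoc]
      rw [← Matrix.mul_assoc Vᴴ, hV, Matrix.one_mul]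
    have h3 : Vᴴ * (V * Y * Vᴴ) * V = Y := by
      rw [Matrix.mul_assoc, Matrix.mul_assoc, Matrix.mul_assoc, hV, Matrix.mul_one,
        ← Matrix.mul_assoc, hV, Matrix.one_mul]
    simp [conjMap, h2, h3]
  -- `p` is the squared norm of `x₀ x₁ (|00⟩ + |11⟩)`.
  refine isLOCCDistillable_of_filter hρ.2 hE₀ (isCP_conjMap _) hE
    ⟨(isCP_conjMap _).add hG, hFG⟩ (p := ((2 * (x 0 * x 1) ^ 2 : ℝ) : ℂ)) ?_ ?_
  · rw [← Complex.ofReal_one, ← Complex.ofReal_sub, Complex.norm_real, Real.norm_eq_abs, abs_lt]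
    have := mul_pos h0 h1
    constructor <;> nlinarith [sq_nonneg (x 0 ^ 2 - x 1 ^ 2), sq_nonneg (x 0 * x 1)]
  · set S : Matrix (Fin 2) (Fin 2) ℂ := diagonal fun i => (x (1 - i) : ℂ) with hS
    have h2 : ((S * Uᴴ) ⊗ₖ (1 : Matrix B B ℂ)) * (U ⊗ₖ V)
        = ((1 : Matrix (Fin 2) (Fin 2) ℂ) ⊗ₖ V) * (S ⊗ₖ (1 : Matrix (Fin 2) (Fin 2) ℂ)) := by
      rw [← mul_kronecker_mul, ← mul_kronecker_mul, Matrix.mul_assoc, hU]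
      simp
    have h3 (T : Matrix (A × B) (Fin 2 × Fin 2) ℂ) (L : Matrix (Fin 2 × B) (A × B) ℂ)
        (σ : Matrix (Fin 2 × Fin 2) (Fin 2 × Fin 2) ℂ) :
        L * (T * σ * Tᴴ) * Lᴴ = (L * T) * σ * (L * T)ᴴ := by
      simp only [conjTranspose_mul, Matrix.mul_assoc]
    rw [tensorIdRight_conjMap, h3, h2, conjTranspose_mul, ← Matrix.mul_assoc,
      Matrix.mul_assoc _ (S ⊗ₖ 1), Matrix.mul_assoc _ (_ * schmidtState x),
      tensorIdLeft_kronecker_conj hF]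
    have h4 : S ⊗ₖ (1 : Matrix (Fin 2) (Fin 2) ℂ)
        = diagonal fun p : Fin 2 × Fin 2 => (x (1 - p.1) : ℂ) := by
      rw [hS, ← diagonal_one, diagonal_kronecker_diagonal]
      simp
    rw [h4, diagonal_conjTranspose]
    ext ⟨i, j⟩ ⟨k, l⟩
    rw [Matrix.mul_diagonal, Matrix.diagonal_mul]
    fin_cases i <;> fin_cases j <;> fin_cases k <;> fin_cases l <;>
      simp [schmidtState, phiPlus, maxEnt] <;> ring

/-! ### Quadratic forms on product vectors. -/

theorem matrix_eq_zero_of_forall_dotProduct {A : Type} [Fintype A] {M : Matrix A A ℂ}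
    (h : ∀ x : A → ℂ, star x ⬝ᵥ M *ᵥ x = 0) : M = 0 := by
  classical
  have h1 : Matrix.toEuclideanLin M = 0 := by
    rw [← inner_map_self_eq_zero]
    intro x
    rw [← inner_conj_symm, EuclideanSpace.inner_eq_star_dotProduct, dotProduct_comm]
    exact (congrArg _ (h x.ofLp)).trans (map_zero _)
  simpa using h1

/-- The coordinates of the product vector `a ⊗ b`. -/
def prodVec {A B : Type} (a : A → ℂ) (b : B → ℂ) : A × B → ℂ := fun p => a p.1 * b p.2

/-- Complex polarization is used twice: in `a` with `b` fixed, then in `b` for each entry of the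
resulting matrix. -/
theorem matrix_eq_zero_of_forall_prodVec {A B : Type} [Fintype A] [Fintype B]
    {w : Matrix (A × B) (A × B) ℂ}
    (h : ∀ a b, star (prodVec a b) ⬝ᵥ w *ᵥ prodVec a b = 0) : w = 0 := by
  have h1 (b : B → ℂ) :
      (Matrix.of fun i k => star b ⬝ᵥ (Matrix.of fun j l => w (i, j) (k, l)) *ᵥ b) = 0 := by
    refine matrix_eq_zero_of_forall_dotProduct fun a => ?_
    rw [← h a b]
    simp only [dotProduct, mulVec, prodVec, Fintype.sum_prod_type, Finset.mul_sum,
      Finset.sum_mul, Matrix.of_apply, Pi.star_apply, star_mul']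
    refine Finset.sum_congr rfl fun i _ => ?_
    rw [Finset.sum_comm]
    refine Finset.sum_congr rfl fun j _ => Finset.sum_congr rfl fun k _ =>
      Finset.sum_congr rfl fun l _ => ?_
    ring
  ext ⟨i, j⟩ ⟨k, l⟩
  have h2 : (Matrix.of fun j l => w (i, j) (k, l)) = 0 :=
    matrix_eq_zero_of_forall_dotProduct fun b => congrFun (congrFun (h1 b) i) k
  exact congrFun (congrFun h2 j) l

/-- Analyticity is taken over `ℝ` because the form involves conjugates. -/
theorem analyticOnNhd_prodVec {A B : Type} [Fintype A] [Fintype B]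
    (w : Matrix (A × B) (A × B) ℂ) :
    AnalyticOnNhd ℝ (fun x : (A → ℂ) × (B → ℂ) =>
      star (prodVec x.1 x.2) ⬝ᵥ w *ᵥ prodVec x.1 x.2) Set.univ := by
  intro x _
  have hA (i : A) : AnalyticAt ℝ (fun x : (A → ℂ) × (B → ℂ) => x.1 i) x :=
    ((ContinuousLinearMap.proj i).comp
      (ContinuousLinearMap.fst ℝ (A → ℂ) (B → ℂ))).analyticAt x
  have hB (i : B) : AnalyticAt ℝ (fun x : (A → ℂ) × (B → ℂ) => x.2 i) x :=
    ((ContinuousLinearMap.proj i).comp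
      (ContinuousLinearMap.snd ℝ (A → ℂ) (B → ℂ))).analyticAt x
  have hP (p : A × B) : AnalyticAt ℝ (fun x : (A → ℂ) × (B → ℂ) => prodVec x.1 x.2 p) x :=
    (hA p.1).mul (hB p.2)
  have hS (p : A × B) : AnalyticAt ℝ (fun x : (A → ℂ) × (B → ℂ) => star (prodVec x.1 x.2 p)) x :=
    (Complex.conjCLE.toContinuousLinearMap.analyticAt _).comp (hP p)
  simp only [dotProduct, mulVec, Pi.star_apply]
  exact Finset.analyticAt_fun_sum _ fun p _ => (hS p).mul
    (Finset.analyticAt_fun_sum _ fun q _ => analyticAt_const.mul (hP q))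

/-- Finitely many nonzero operators have a product vector on which none of their quadratic forms
vanishes. -/
theorem exists_prodVec_forall_ne_zero {A B ι : Type} [Fintype A] [Fintype B] [Finite ι]
    (w : ι → Matrix (A × B) (A × B) ℂ) (hw : ∀ i, w i ≠ 0) :
    ∃ a b, ∀ i, star (prodVec a b) ⬝ᵥ w i *ᵥ prodVec a b ≠ 0 := by
  have hc (i : ι) := continuousOn_univ.mp (analyticOnNhd_prodVec (w i)).continuousOn
  have hd : Dense (⋂ i, {x : (A → ℂ) × (B → ℂ) |
      star (prodVec x.1 x.2) ⬝ᵥ w i *ᵥ prodVec x.1 x.2 ≠ 0}) := by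
    refine dense_iInter_of_isOpen (fun i => isOpen_ne_fun (hc i) continuous_const) fun i => ?_
    rw [← Set.compl_ofPred, ← interior_eq_empty_iff_dense_compl, Set.eq_empty_iff_forall_notMem]
    intro x hx
    -- If the zero set had an interior point, the identity theorem would make the form vanish
    -- everywhere.
    refine hw i (matrix_eq_zero_of_forall_prodVec fun a b => ?_)
    exact (analyticOnNhd_prodVec (w i)).eqOn_zero_of_preconnected_of_eventuallyEq_zero
      isPreconnected_univ (Set.mem_univ x) (mem_interior_iff_mem_nhds.mp hx) (Set.mem_univ (a, b))
  obtain ⟨⟨a, b⟩, hx⟩ := hd.nonempty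
  exact ⟨a, b, Set.mem_iInter.mp hx⟩

/-- A nonzero vector is, up to a scalar, the first column of an isometry from `ℂ²`. -/
theorem exists_isometry_col {A : Type} [Fintype A] (hA : 2 ≤ Fintype.card A) {a : A → ℂ}
    (ha : a ≠ 0) :
    ∃ (U : Matrix A (Fin 2) ℂ) (r : ℂ), Uᴴ * U = 1 ∧ r ≠ 0 ∧ ∀ i, U i 0 = r * a i := by
  classical
  obtain ⟨i, j, hij⟩ := Fintype.exists_pair_of_one_lt_card hA
  set v : EuclideanSpace ℂ A := WithLp.toLp 2 a
  have hv : v ≠ 0 := fun h => ha (congrArg WithLp.ofLp h)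
  have hn : (‖v‖ : ℂ) ≠ 0 := by simpa using hv
  -- The normalized vector becomes basis vector `i`; basis vector `j` serves as the second column.
  obtain ⟨e, he⟩ := Orthonormal.exists_orthonormalBasis_extension_of_card_eq (𝕜 := ℂ)
    (E := EuclideanSpace ℂ A) (ι := A) (by simp) (v := fun _ => (‖v‖ : ℂ)⁻¹ • v) (s := {i})
    (by
      rw [orthonormal_subsingleton_iff]
      intro _
      simp [norm_smul, hv])
  refine ⟨Matrix.of fun k l => e (![i, j] l) k, (‖v‖ : ℂ)⁻¹, ?_, inv_ne_zero hn, fun k => ?_⟩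
  · ext k l
    have h := orthonormal_iff_ite.mp e.orthonormal (![i, j] k) (![i, j] l)
    rw [EuclideanSpace.inner_eq_star_dotProduct, dotProduct_comm] at h
    refine Eq.trans (b := if ![i, j] k = ![i, j] l then (1 : ℂ) else 0) ?_ ?_
    · rw [← h]
      rfl
    · fin_cases k <;> fin_cases l <;> simp [hij, hij.symm]
  · simp [he i rfl, v]

/-! ### Witnesses evaluated on replacement maps. -/

theorem choi_replacement_apply {A C : Type} [Fintype A] [DecidableEq A] (ρ : Matrix C C ℂ)
    (p q : C × A) : choi (replacement (A := A) ρ) p q = if p.2 = q.2 then ρ p.1 q.1 else 0 := by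
  simp [choi, tensorIdRight, replacement, maxEnt, Matrix.trace, ite_and]

theorem trace_mul_choi_replacement {A C : Type} [Fintype A] [Fintype C] [DecidableEq A]
    (W : Matrix (C × A) (C × A) ℂ) (ρ : Matrix C C ℂ) :
    (W * choi (replacement (A := A) ρ)).trace = (discardRight C A W * ρ).trace := by
  simp only [Matrix.trace, Matrix.diag_apply, Matrix.mul_apply, choi_replacement_apply, discardRight,
    sumSubmatrix_apply, Fintype.sum_prod_type, Finset.sum_mul, mul_ite, mul_zero,
    Finset.sum_ite_eq', Finset.mem_univ, if_true]
  exact Finset.sum_congr rfl fun c _ => Finset.sum_comm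

theorem trace_regroup_mul_kronecker {A₁ B₁ A₂ B₂ : Type} [Fintype A₁] [Fintype B₁] [Fintype A₂]
    [Fintype B₂] [DecidableEq A₁] [DecidableEq B₁]
    (W : Matrix ((A₂ × B₂) × (A₁ × B₁)) ((A₂ × B₂) × (A₁ × B₁)) ℂ)
    (τ : Matrix A₂ A₂ ℂ) (ω : Matrix B₂ B₂ ℂ) :
    (regroup W * ((τ ⊗ₖ (1 : Matrix A₁ A₁ ℂ)) ⊗ₖ (ω ⊗ₖ (1 : Matrix B₁ B₁ ℂ)))).trace
      = (discardRight (A₂ × B₂) (A₁ × B₁) W * (τ ⊗ₖ ω)).trace := by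
  rw [← trace_mul_choi_replacement]
  have h (p q : (A₂ × B₂) × (A₁ × B₁)) : choi (replacement (A := A₁ × B₁) (τ ⊗ₖ ω)) p q
      = ((τ ⊗ₖ (1 : Matrix A₁ A₁ ℂ)) ⊗ₖ (ω ⊗ₖ (1 : Matrix B₁ B₁ ℂ)))
        (Equiv.prodProdProdComm _ _ _ _ p) (Equiv.prodProdProdComm _ _ _ _ q) := by
    rw [choi_replacement_apply]
    by_cases h1 : p.2.1 = q.2.1 <;> by_cases h2 : p.2.2 = q.2.2 <;>
      simp [Prod.ext_iff, h1, h2]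
  simp only [Matrix.trace, Matrix.diag_apply, Matrix.mul_apply]
  rw [← (Equiv.prodProdProdComm A₂ B₂ A₁ B₁).sum_comp]
  refine Finset.sum_congr rfl fun p _ => ?_
  rw [← (Equiv.prodProdProdComm A₂ B₂ A₁ B₁).sum_comp]
  refine Finset.sum_congr rfl fun q _ => ?_
  rw [h]
  rfl

/-- Witnesses are tested only on normalized states, so one rescales by the trace; trace zero forces
the operator to vanish. -/
theorem IsEntanglementWitness.trace_mul_kronecker_nonneg {A B : Type} [Fintype A] [Fintype B]
    {W : Matrix (A × B) (A × B) ℂ} (hW : IsEntanglementWitness W) {τ : Matrix A A ℂ}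
    {ω : Matrix B B ℂ} (hτ : τ.PosSemidef) (hω : ω.PosSemidef) : 0 ≤ (W * (τ ⊗ₖ ω)).trace := by
  have hσ : (τ ⊗ₖ ω).PosSemidef := hτ.kronecker hω
  rcases hσ.trace_nonneg.eq_or_lt with h0 | h0
  · rw [hσ.trace_eq_zero_iff.mp h0.symm]
    simp
  · have hi : 0 ≤ (τ ⊗ₖ ω).trace⁻¹ := (inv_pos.mpr h0).le
    have h := hW.2 ((τ ⊗ₖ ω).trace⁻¹ • (τ ⊗ₖ ω))
      ⟨hσ.smul hi, by rw [Matrix.trace_smul, smul_eq_mul, inv_mul_cancel₀ h0.ne']⟩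
      ⟨1, fun _ => (τ ⊗ₖ ω).trace⁻¹ • τ, fun _ => ω, fun _ => hτ.smul hi, fun _ => hω,
        by simp [smul_kronecker]⟩
    rw [Matrix.mul_smul, Matrix.trace_smul, smul_eq_mul] at h
    have h2 := mul_nonneg h0.le h
    rwa [← mul_assoc, mul_inv_cancel₀ h0.ne', one_mul] at h2

theorem trace_mul_vecMulVec_star {A : Type} [Fintype A] (M : Matrix A A ℂ) (v : A → ℂ) :
    (M * vecMulVec v (star v)).trace = star v ⬝ᵥ M *ᵥ v := by
  rw [Matrix.mul_vecMulVec, Matrix.trace_vecMulVec, dotProduct_comm]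

theorem vecMulVec_prodVec {A B : Type} (a : A → ℂ) (b : B → ℂ) :
    vecMulVec (prodVec a b) (star (prodVec a b))
      = vecMulVec a (star a) ⊗ₖ vecMulVec b (star b) := by
  ext p q
  simp [vecMulVec_apply, prodVec]
  ring

/-- The partial trace over `A₁ B₁` of an entanglement witness is block positive. -/
theorem dotProduct_discardRight_nonneg {A₁ B₁ A₂ B₂ : Type} [Fintype A₁] [Fintype B₁] [Fintype A₂]
    [Fintype B₂] {W : Matrix ((A₂ × B₂) × (A₁ × B₁)) ((A₂ × B₂) × (A₁ × B₁)) ℂ}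
    (hW : IsEntanglementWitness (regroup W)) (a : A₂ → ℂ) (b : B₂ → ℂ) :
    0 ≤ star (prodVec a b) ⬝ᵥ discardRight (A₂ × B₂) (A₁ × B₁) W *ᵥ prodVec a b := by
  classical
  rw [← trace_mul_vecMulVec_star, vecMulVec_prodVec, ← trace_regroup_mul_kronecker]
  exact hW.trace_mul_kronecker_nonneg
    ((posSemidef_vecMulVec_self_star a).kronecker PosSemidef.one)
    ((posSemidef_vecMulVec_self_star b).kronecker PosSemidef.one)

theorem isHermitian_discardRight {A₁ B₁ A₂ B₂ : Type} [Fintype A₁] [Fintype B₁]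
    {W : Matrix ((A₂ × B₂) × (A₁ × B₁)) ((A₂ × B₂) × (A₁ × B₁)) ℂ}
    (hW : (regroup W).IsHermitian) : (discardRight (A₂ × B₂) (A₁ × B₁) W).IsHermitian := by
  ext p q
  rw [Matrix.conjTranspose_apply, discardRight, sumSubmatrix_apply, sumSubmatrix_apply, star_sum]
  exact Finset.sum_congr rfl fun r _ => hW.apply ((p.1, r.1), (p.2, r.2)) ((q.1, r.1), (q.2, r.2))

/-- The order on `ℂ` also demands a zero imaginary part, while the perturbation argument controls
only the real part. -/
theorem trace_mul_im_eq_zero {A : Type} [Fintype A] {M N : Matrix A A ℂ} (hM : M.IsHermitian)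
    (hN : N.IsHermitian) : (M * N).trace.im = 0 := by
  have h : star (M * N).trace = (M * N).trace := by
    rw [← Matrix.trace_conjTranspose, Matrix.conjTranspose_mul, hM.eq, hN.eq, Matrix.trace_mul_comm]
  exact Complex.conj_eq_iff_im.mp h

/-! ### Perturbing a product vector to an entangled one. -/

/-- Finitely many block positive operators are nonnegative on a common entangled pure state of
Schmidt rank two. -/
theorem exists_schmidtState_trace_nonneg {A B : Type} [Fintype A] [Fintype B]
    (hA : 2 ≤ Fintype.card A) (hB : 2 ≤ Fintype.card B) {ι : Type} [Finite ι]
    {w : ι → Matrix (A × B) (A × B) ℂ} (hw : ∀ i, (w i).IsHermitian)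
    (hpos : ∀ i a b, 0 ≤ star (prodVec a b) ⬝ᵥ w i *ᵥ prodVec a b) :
    ∃ (U : Matrix A (Fin 2) ℂ) (V : Matrix B (Fin 2) ℂ) (x : Fin 2 → ℝ),
      Uᴴ * U = 1 ∧ Vᴴ * V = 1 ∧ 0 < x 0 ∧ 0 < x 1 ∧ x 0 ^ 2 + x 1 ^ 2 = 1 ∧
      ∀ i, 0 ≤ (w i * ((U ⊗ₖ V) * schmidtState x * (U ⊗ₖ V)ᴴ)).trace := by
  classical
  have : Nonempty A := Fintype.card_pos_iff.mp (by omega)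
  have : Nonempty B := Fintype.card_pos_iff.mp (by omega)
  -- The extra index `none` carries the identity, which forces `a ⊗ b ≠ 0` even when every `w i`
  -- vanishes.
  obtain ⟨a, b, hab⟩ := exists_prodVec_forall_ne_zero
    (fun o : Option {i // w i ≠ 0} => o.elim (1 : Matrix (A × B) (A × B) ℂ) fun i => w i)
    (by rintro (_ | i); exacts [one_ne_zero, i.2])
  have hv : prodVec a b ≠ 0 := fun h => hab none (by simp [h])
  have ha : a ≠ 0 := by rintro rfl; exact hv (by ext; simp [prodVec])
  have hb : b ≠ 0 := by rintro rfl; exact hv (by ext; simp [prodVec])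
  obtain ⟨U, r, hU, hr, hUa⟩ := exists_isometry_col hA ha
  obtain ⟨V, s, hV, hs, hVb⟩ := exists_isometry_col hB hb
  set x : ℝ → Fin 2 → ℝ := fun t => ![Real.cos t, Real.sin t] with hx
  set ρ : ℝ → Matrix (A × B) (A × B) ℂ :=
    fun t => (U ⊗ₖ V) * schmidtState (x t) * (U ⊗ₖ V)ᴴ with hρ
  have hx1 (t : ℝ) : x t 0 ^ 2 + x t 1 ^ 2 = 1 := by simp [hx]
  have hρc : Continuous ρ := by
    have h1 (i : Fin 2) : Continuous fun t => x t i := by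
      fin_cases i
      exacts [Real.continuous_cos, Real.continuous_sin]
    have h2 : Continuous fun t => schmidtState (x t) := by
      refine continuous_matrix fun p q => ?_
      simp only [schmidtState, Matrix.of_apply]
      split_ifs
      · exact (Complex.continuous_ofReal.comp (h1 _)).mul (Complex.continuous_ofReal.comp (h1 _))
      · exact continuous_const
    fun_prop
  have hρ0 : ρ 0 = vecMulVec ((r * s) • prodVec a b) (star ((r * s) • prodVec a b)) := by
    have h1 : schmidtState (x 0) = Matrix.single (0, 0) (0, 0) 1 := by
      ext ⟨i, j⟩ ⟨k, l⟩
      fin_cases i <;> fin_cases j <;> fin_cases k <;> fin_cases l <;>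
        simp [schmidtState, hx]
    ext p q
    simp [hρ, h1, Matrix.mul_apply, Matrix.single_apply, ite_and, vecMulVec_apply, prodVec, hUa,
      hVb]
    ring
  have hpos0 (i : ι) (hi : w i ≠ 0) : 0 < (w i * ρ 0).trace.re := by
    have h1 : 0 < star (prodVec a b) ⬝ᵥ w i *ᵥ prodVec a b :=
      (hpos i a b).lt_of_ne (hab (some ⟨i, hi⟩)).symm
    rw [hρ0, trace_mul_vecMulVec_star, Matrix.mulVec_smul, star_smul, smul_dotProduct,
      dotProduct_smul, smul_smul, smul_eq_mul]
    exact (Complex.pos_iff.mp (mul_pos (star_mul_self_pos (IsRegular.of_ne_zero (mul_ne_zero hr hs))) h1)).1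
  -- Strict positivity at `t = 0` survives for small `t`; taking `t > 0` makes `sin t`, the second
  -- Schmidt coefficient, positive.
  have hev : ∀ᶠ t in nhdsWithin (0 : ℝ) (Set.Ioi 0), ∀ i, w i ≠ 0 → 0 < (w i * ρ t).trace.re := by
    refine Filter.eventually_all.mpr fun i => ?_
    by_cases hi : w i = 0
    · simp [hi]
    have hc : Continuous fun t => (w i * ρ t).trace.re := by fun_prop
    exact ((hc.tendsto 0).eventually (lt_mem_nhds (hpos0 i hi))).filter_mono nhdsWithin_le_nhds
      |>.mono fun t ht _ => ht
  obtain ⟨t, ht, ht0, ht1⟩ :=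
    (hev.and (Ioo_mem_nhdsGT (show (0 : ℝ) < Real.pi / 2 by positivity))).exists
  refine ⟨U, V, x t, hU, hV, Real.cos_pos_of_mem_Ioo ⟨by linarith, ht1⟩,
    Real.sin_pos_of_pos_of_lt_pi ht0 (by linarith), hx1 t, fun i => ?_⟩
  by_cases hi : w i = 0
  · simp [hi]
  · refine Complex.nonneg_iff.mpr ⟨(ht i hi).le, (trace_mul_im_eq_zero (hw i) ?_).symm⟩
    exact ((isState_schmidtState (hx1 t)).isometry_conj (kronecker_isometry hU hV)).1.isHermitian

end QInfo

theorem mainTheorem3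
    {A₁ B₁ A₂ B₂ : Type}
    [Fintype A₁] [Fintype B₁] [Fintype A₂] [Fintype B₂]
    [DecidableEq A₁] [DecidableEq B₁]
    (hA₂ : 2 ≤ Fintype.card A₂) (hB₂ : 2 ≤ Fintype.card B₂)
    (n : ℕ)
    (W : Fin n → Matrix ((A₂ × B₂) × (A₁ × B₁)) ((A₂ × B₂) × (A₁ × B₁)) ℂ)
    (hW : ∀ i, QInfo.IsEntanglementWitness (QInfo.regroup (W i))) :
    ∃ ρ : Matrix (A₂ × B₂) (A₂ × B₂) ℂ,
      QInfo.IsState ρ ∧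
      QInfo.IsTwoQubitState ρ ∧
      ¬ QInfo.IsSeparable ρ ∧
      QInfo.IsLOCCDistillable ρ ∧
      ∃ Λ : QInfo.SuperOp (A₁ × B₁) (A₂ × B₂),
        Λ = QInfo.replacement ρ ∧
        QInfo.IsChannel Λ ∧
        QInfo.EntanglingUndetected W Λ ∧
        ∀ σ : Matrix (A₁ × B₁) (A₁ × B₁) ℂ, QInfo.IsState σ → Λ σ = ρ := by
  obtain ⟨U, V, x, hU, hV, h0, h1, hx, hw⟩ := QInfo.exists_schmidtState_trace_nonneg hA₂ hB₂
    (fun i => QInfo.isHermitian_discardRight (hW i).1)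
    (fun i => QInfo.dotProduct_discardRight_nonneg (hW i))
  have hρ := (QInfo.isState_schmidtState hx).isometry_conj (QInfo.kronecker_isometry hU hV)
  refine ⟨_, hρ, ⟨U, V, _, hU, hV, QInfo.isState_schmidtState hx, rfl⟩,
    QInfo.not_isSeparable_isometry_conj hU hV (QInfo.not_isSeparable_schmidtState h0 h1),
    QInfo.isLOCCDistillable_schmidtState hU hV h0 h1 hx, _, rfl, QInfo.isChannel_replacement hρ,
    ⟨QInfo.isCP_replacement hρ.1, fun i => ?_⟩, fun σ hσ => ?_⟩
  · rw [QInfo.trace_mul_choi_replacement]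
    exact hw i
  · simp [QInfo.replacement, hσ.2]
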